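/- Let $n\ge 1$ and $Y=(0,1)^n$. For $k\in\mathbb N$, $L^2_{\mathrm{per}}(Y)$ and $H^k_{\mathrm{per}}(Y)$ denote the spaces of $Y$-periodic functions that are square integrable over $Y$, respectively that have in addition $Y$-periodic weak derivatives up to order $k$ that are square integrable over $Y$; functions are identified if they agree almost everywhere. Let $H^1_{\mathrm{per},0}(Y;\mathbb R^n)$ be the space of $v\in H^1_{\mathrm{per}}(Y;\mathbb R^n)$ with $\int_Y v=0$, equipped with the $H^1(Y)$-norm, and let $(Dv)_{ij}=\partial_j v_i$. Let $A\in L^\infty_{\mathrm{per}}(Y;\mathbb R^{n\times n}_{\mathrm{sym}})$ and $b\in L^\infty_{\mathrm{per}}(Y;\mathbb R^n)$ be such that $\lambda I_n\le A\le\Lambda I_n$ a.e. in $\mathbb R^n$ for some $\lambda,\Lambda>0$, and such that for some $\delta\in\left(\frac{n}{n+\pi^2},1\right]$ $$\frac{|A|^2+|b|^2}{(\mathrm{tr}(A))^2}\le\frac{1}{n-1+\delta}\quad\text{a.e. in }\mathbb R^n,$$ where $|A|^2=A:A$ and $|b|^2=b\cdot b$. Set $$\gamma=\frac{\mathrm{tr}(A)}{|A|^2+|b|^2},\qquad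 \tilde A=\gamma A,\qquad \tilde b=\gamma b,$$ and for $v,w\in H^1_{\mathrm{per},0}(Y;\mathbb R^n)$ define $$B_2(v,w)=\int_Y(\nabla\cdot v)\left(\tilde A:Dw+\tilde b\cdot w\right)+\frac12\int_Y\left(Dv-(Dv)^{\mathrm T}\right):\left(Dw-(Dw)^{\mathrm T}\right).$$ Then $B_2$ is a bounded and coercive bilinear form on $H^1_{\mathrm{per},0}(Y;\mathbb R^n)$. There exists a unique $\rho\in H^1_{\mathrm{per},0}(Y;\mathbb R^n)$ such that $$B_2(\rho,w)=\int_Y\left(\tilde A:Dw+\tilde b\cdot w\right)\qquad\forall w\in H^1_{\mathrm{per},0}(Y;\mathbb R^n).$$ Moreover, there is exactly one $\tilde r\in L^2_{\mathrm{per}}(Y)$ with $\int_Y\tilde r=1$ and $$\int_Y\tilde r\left(\tilde A:D^2\varphi+\tilde b\cdot\nabla\varphi\right)=0\qquad\forall\varphi\in H^2_{\mathrm{per}}(Y)$$ (that is, one very weak $Y$-periodic solution of $-D^2:(\tilde A\tilde r)+\nabla\cdot(\tilde b\tilde r)=0$ in $Y$ with $\int_Y\tilde r=1$), and it is given by $\tilde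 r=1-\nabla\cdot\rho$. -/

import Mathlib

open MeasureTheory
open scoped ContDiff Matrix

noncomputable section

namespace PeriodicFPK

/-- The open unit cell `Y = (0,1)^n` of `ℝ^n`. -/
def unitCell (n : ℕ) : Set (Fin n → ℝ) := Set.univ.pi fun _ => Set.Ioo (0 : ℝ) 1

/-- `L²_per(Y)`. A `Y`-periodic function is determined almost everywhere by its restriction to `Y`,
and every function on `Y` has a `Y`-periodic extension, unique up to null sets; accordingly
`L²_per(Y)` is the space `L²(Y)` of classes of square integrable functions on `Y`. -/
abbrev L2per (n : ℕ) : Type := Lp ℝ 2 ((volume : Measure (Fin n → ℝ)).restrict (unitCell n))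

/-- `C^∞_per(Y)`: smooth functions on the whole of `ℝ^n` that have period `1` in each coordinate. -/
structure IsSmoothPeriodic {n : ℕ} (φ : (Fin n → ℝ) → ℝ) : Prop where
  smooth : ContDiff ℝ ∞ φ
  periodic : ∀ (i : Fin n) (x : Fin n → ℝ), φ (x + Pi.single i 1) = φ x

/-- The classical partial derivative `∂_i φ`. -/
def partialDeriv {n : ℕ} (i : Fin n) (φ : (Fin n → ℝ) → ℝ) (x : Fin n → ℝ) : ℝ :=
  fderiv ℝ φ x (Pi.single i 1)

/-- `g = ∂_i u` weakly (for the `Y`-periodic extensions of `u` and `g`):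
`∫_Y u ∂_i φ = - ∫_Y g φ` for all `φ ∈ C^∞_per(Y)`. -/
def IsWeakPartial {n : ℕ} (i : Fin n) (u g : L2per n) : Prop :=
  ∀ φ : (Fin n → ℝ) → ℝ, IsSmoothPeriodic φ →
    ∫ x in unitCell n, u x * partialDeriv i φ x = - ∫ x in unitCell n, g x * φ x

/-! Closure of weak differentiability and of the zero mean condition under linear combinations. -/

theorem integrable_mul_continuous {n : ℕ} (u : L2per n) {ψ : (Fin n → ℝ) → ℝ}
    (hψ : Continuous ψ) :
    Integrable (fun x => u x * ψ x) (volume.restrict (unitCell n)) := by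
  have hsub : unitCell n ⊆ Set.Icc (0 : Fin n → ℝ) 1 := fun x hx => by
    simp only [unitCell, Set.mem_univ_pi, Set.mem_Ioo] at hx
    exact ⟨fun i => (hx i).1.le, fun i => (hx i).2.le⟩
  have hfin : IsFiniteMeasure ((volume : Measure (Fin n → ℝ)).restrict (unitCell n)) :=
    ⟨by
      rw [Measure.restrict_apply_univ]
      exact (measure_mono hsub).trans_lt isCompact_Icc.measure_lt_top⟩
  obtain ⟨C, hC⟩ := (isCompact_Icc (a := (0 : Fin n → ℝ)) (b := 1)).exists_bound_of_continuousOn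
    hψ.continuousOn
  have hu : Integrable (fun x => u x) (volume.restrict (unitCell n)) :=
    (Lp.memLp u).integrable (by norm_num)
  have hm : MeasurableSet (unitCell n) := MeasurableSet.univ_pi fun _ => measurableSet_Ioo
  exact hu.mul_bdd (c := C) hψ.aestronglyMeasurable
    ((ae_restrict_iff' hm).2 (Filter.Eventually.of_forall fun x hx => hC x (hsub hx)))

theorem integral_add_mul {n : ℕ} (u v : L2per n) {ψ : (Fin n → ℝ) → ℝ} (hψ : Continuous ψ) :
    ∫ x in unitCell n, (u + v : L2per n) x * ψ x =
      (∫ x in unitCell n, u x * ψ x) + ∫ x in unitCell n, v x * ψ x := by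
  rw [← integral_add (integrable_mul_continuous u hψ) (integrable_mul_continuous v hψ)]
  refine integral_congr_ae ?_
  filter_upwards [Lp.coeFn_add u v] with x hx
  rw [hx, Pi.add_apply, add_mul]

theorem integral_smul_mul {n : ℕ} (c : ℝ) (u : L2per n) (ψ : (Fin n → ℝ) → ℝ) :
    ∫ x in unitCell n, (c • u : L2per n) x * ψ x = c * ∫ x in unitCell n, u x * ψ x := by
  rw [← integral_const_mul]
  refine integral_congr_ae ?_
  filter_upwards [Lp.coeFn_smul c u] with x hx
  rw [hx, Pi.smul_apply, smul_eq_mul, mul_assoc]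

theorem IsSmoothPeriodic.continuous_partialDeriv {n : ℕ} {φ : (Fin n → ℝ) → ℝ}
    (hφ : IsSmoothPeriodic φ) (i : Fin n) : Continuous (partialDeriv i φ) :=
  (hφ.smooth.continuous_fderiv (by simp)).clm_apply continuous_const

theorem IsWeakPartial.add {n : ℕ} {i : Fin n} {u g v h : L2per n}
    (hu : IsWeakPartial i u g) (hv : IsWeakPartial i v h) : IsWeakPartial i (u + v) (g + h) := by
  intro φ hφ
  rw [integral_add_mul u v (hφ.continuous_partialDeriv i),
    integral_add_mul g h hφ.smooth.continuous, hu φ hφ, hv φ hφ, neg_add]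

theorem IsWeakPartial.smul {n : ℕ} {i : Fin n} (c : ℝ) {u g : L2per n}
    (hu : IsWeakPartial i u g) : IsWeakPartial i (c • u) (c • g) := by
  intro φ hφ
  rw [integral_smul_mul, integral_smul_mul, hu φ hφ, mul_neg]

theorem integral_add_eq {n : ℕ} (u v : L2per n) :
    ∫ x in unitCell n, (u + v : L2per n) x =
      (∫ x in unitCell n, u x) + ∫ x in unitCell n, v x := by
  simpa using integral_add_mul u v (continuous_const (y := (1 : ℝ)))

theorem integral_smul_eq {n : ℕ} (c : ℝ) (u : L2per n) :
    ∫ x in unitCell n, (c • u : L2per n) x = c * ∫ x in unitCell n, u x := by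
  simpa using integral_smul_mul c u fun _ => 1

/-- The Hilbert space `L²_per(Y;ℝ^n) × L²_per(Y;ℝ^{n×n})`, with
`‖(v, G)‖² = ∑ i, ‖v i‖² + ∑ i j, ‖G (i, j)‖²`. -/
abbrev FieldWithGrad (n : ℕ) : Type :=
  WithLp 2 (PiLp 2 (fun _ : Fin n => L2per n) × PiLp 2 (fun _ : Fin n × Fin n => L2per n))

/-- `H¹_{per,0}(Y;ℝ^n)`: vector fields with `Y`-periodic weak derivatives in `L²` and zero mean.
An element is recorded as the pair `(v, Dv)`, `(Dv)_{ij} = ∂_j v_i`; since weak derivatives are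
unique this is the field `v` itself, and the norm inherited from `FieldWithGrad n` is the `H¹` norm
`(‖v‖²_{L²} + ‖Dv‖²_{L²})^{1/2}`. -/
def H1perZero (n : ℕ) : Submodule ℝ (FieldWithGrad n) where
  carrier := {u | (∀ i j, IsWeakPartial j (u.fst i) (u.snd (i, j))) ∧
    ∀ i, ∫ x in unitCell n, u.fst i x = 0}
  zero_mem' := by
    refine ⟨fun i j => ?_, fun i => ?_⟩
    · have h : IsWeakPartial j ((0 : ℝ) • (0 : L2per n)) ((0 : ℝ) • (0 : L2per n)) := by
        intro φ _
        rw [integral_smul_mul, integral_smul_mul, zero_mul, zero_mul, neg_zero]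
      rw [smul_zero] at h
      exact h
    · have h := integral_smul_eq (0 : ℝ) (0 : L2per n)
      rw [smul_zero, zero_mul] at h
      exact h
  add_mem' := by
    rintro u v ⟨hu, hu'⟩ ⟨hv, hv'⟩
    refine ⟨fun i j => (hu i j).add (hv i j), fun i => ?_⟩
    have h := integral_add_eq (u.fst i) (v.fst i)
    rw [hu' i, hv' i, add_zero] at h
    exact h
  smul_mem' := by
    rintro c u ⟨hu, hu'⟩
    refine ⟨fun i j => (hu i j).smul c, fun i => ?_⟩
    have h := integral_smul_eq c (u.fst i)
    rw [hu' i, mul_zero] at h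
    exact h

/-- The component `v_i`. -/
def comp {n : ℕ} (v : H1perZero n) (i : Fin n) : L2per n := v.1.fst i

/-- The entry `(Dv)_{ij} = ∂_j v_i`. -/
def grad {n : ℕ} (v : H1perZero n) (i j : Fin n) : L2per n := v.1.snd (i, j)

/-- The divergence `∇·v = ∑ i, ∂_i v_i` (as a function on `Y`). -/
def div {n : ℕ} (v : H1perZero n) (x : Fin n → ℝ) : ℝ := ∑ i, grad v i i x

/-- `A : G + b · p` at the point `x`. -/
def firstOrderTerm {n : ℕ} (A : (Fin n → ℝ) → Matrix (Fin n) (Fin n) ℝ)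
    (b : (Fin n → ℝ) → Fin n → ℝ) (G : Fin n → Fin n → L2per n) (p : Fin n → L2per n)
    (x : Fin n → ℝ) : ℝ :=
  (∑ i, ∑ j, A x i j * G i j x) + ∑ i, b x i * p i x

/-- `B(v,w) = ∫_Y (∇·v)(A:Dw + b·w) + ½ ∫_Y (Dv - Dvᵀ):(Dw - Dwᵀ)`. -/
def bilinForm {n : ℕ} (A : (Fin n → ℝ) → Matrix (Fin n) (Fin n) ℝ)
    (b : (Fin n → ℝ) → Fin n → ℝ) (v w : H1perZero n) : ℝ :=
  (∫ x in unitCell n, div v x * firstOrderTerm A b (grad w) (comp w) x) +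
    (1 / 2) * ∫ x in unitCell n,
      ∑ i, ∑ j, (grad v i j x - grad v j i x) * (grad w i j x - grad w j i x)

/-- `A : A + b · b`, that is `|A|² + |b|²`, at the point `x`. -/
def sqNorm {n : ℕ} (A : (Fin n → ℝ) → Matrix (Fin n) (Fin n) ℝ)
    (b : (Fin n → ℝ) → Fin n → ℝ) (x : Fin n → ℝ) : ℝ :=
  (∑ i, ∑ j, A x i j ^ 2) + ∑ i, b x i ^ 2

/-- `(A, b) ∈ 𝓑`: essentially bounded `Y`-periodic coefficients on `ℝ^n` with `A` symmetric and
uniformly elliptic, satisfying the Cordes-type condition. -/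
structure SettingB {n : ℕ} (A : (Fin n → ℝ) → Matrix (Fin n) (Fin n) ℝ)
    (b : (Fin n → ℝ) → Fin n → ℝ) : Prop where
  memLp_A : ∀ i j, MemLp (fun x => A x i j) ⊤ volume
  memLp_b : ∀ i, MemLp (fun x => b x i) ⊤ volume
  periodic_A : ∀ k : Fin n, ∀ᵐ x, A (x + Pi.single k 1) = A x
  periodic_b : ∀ k : Fin n, ∀ᵐ x, b (x + Pi.single k 1) = b x
  symm_A : ∀ᵐ x, (A x).IsSymm
  elliptic : ∃ lam Lam : ℝ, 0 < lam ∧ 0 < Lam ∧ ∀ᵐ x, ∀ ξ : Fin n → ℝ,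
    lam * (ξ ⬝ᵥ ξ) ≤ ξ ⬝ᵥ (A x *ᵥ ξ) ∧ ξ ⬝ᵥ (A x *ᵥ ξ) ≤ Lam * (ξ ⬝ᵥ ξ)
  cordes : ∃ δ : ℝ, n / (n + Real.pi ^ 2) < δ ∧ δ ≤ 1 ∧
    ∀ᵐ x, sqNorm A b x / (A x).trace ^ 2 ≤ 1 / (n - 1 + δ)

/-- The renormalization function `γ = tr(A) / (|A|² + |b|²)`. -/
def gam {n : ℕ} (A : (Fin n → ℝ) → Matrix (Fin n) (Fin n) ℝ)
    (b : (Fin n → ℝ) → Fin n → ℝ) (x : Fin n → ℝ) : ℝ :=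
  (A x).trace / sqNorm A b x

/-- The renormalized diffusion matrix `Ã = γ A`. -/
def renormA {n : ℕ} (A : (Fin n → ℝ) → Matrix (Fin n) (Fin n) ℝ)
    (b : (Fin n → ℝ) → Fin n → ℝ) (x : Fin n → ℝ) : Matrix (Fin n) (Fin n) ℝ :=
  gam A b x • A x

/-- The renormalized drift `b̃ = γ b`. -/
def renormb {n : ℕ} (A : (Fin n → ℝ) → Matrix (Fin n) (Fin n) ℝ)
    (b : (Fin n → ℝ) → Fin n → ℝ) (x : Fin n → ℝ) : Fin n → ℝ :=
  gam A b x • b x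

/-- `u ∈ L²_per(Y)` is a (very weak) `Y`-periodic solution of `-D²:(A u) + ∇·(b u) = 0` in `Y`:
`∫_Y u (A : D²φ + b · ∇φ) = 0` for all `φ ∈ H²_per(Y)`. Here `φ ∈ H²_per(Y)` is given together with
its weak gradient `p` and its weak Hessian `H`. -/
def IsVeryWeakSolution {n : ℕ} (A : (Fin n → ℝ) → Matrix (Fin n) (Fin n) ℝ)
    (b : (Fin n → ℝ) → Fin n → ℝ) (u : L2per n) : Prop :=
  ∀ (φ : L2per n) (p : Fin n → L2per n) (H : Fin n → Fin n → L2per n),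
    (∀ i, IsWeakPartial i φ (p i)) → (∀ i j, IsWeakPartial j (p i) (H i j)) →
      ∫ x in unitCell n, u x * firstOrderTerm A b H p x = 0

end PeriodicFPK

end

noncomputable section

namespace PeriodicFPK

open scoped ComplexConjugate

/-!
The renormalized operator `w ↦ Ã : Dw + b̃ · w` is close to the divergence: since
`tr Ã = |Ã|² + |b̃|² = tr(A)² / (|A|² + |b|²)`, the Cordes condition says exactly that
`|Ã - I|² + |b̃|² ≤ 1 - δ`. For periodic fields `‖∇·w‖² + ½ ‖Dw - Dwᵀ‖² = ‖Dw‖²`, so the form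
is `‖Dw‖²` up to the term `⟨∇·w, (Ã - I) : Dw + b̃ · w⟩`, which Young's inequality and the Poincaré
inequality `4π² ‖w‖² ≤ ‖Dw‖²` absorb as soon as `1 - δ < 4π² / (1 + 4π²)`. The Lax–Milgram theorem
yields `ρ`. On gradients `w = ∇φ` the skew part of the form vanishes, so that `1 - ∇·ρ` is a very
weak solution. It is the only one of unit mean: the difference `q` of two of them has zero mean,
hence is `∇·∇φ` for some `φ ∈ H²_per(Y)` by the periodic Poisson equation, and then the form
vanishes at `(∇φ, ∇φ)`, so `∇φ = 0`. Poincaré's inequality, the symmetry of second derivatives and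
the Poisson equation are all read off from Fourier coefficients.
-/

variable {n : ℕ}

/-- Lebesgue measure on the unit cell. -/
abbrev cellMeasure (n : ℕ) : Measure (Fin n → ℝ) := volume.restrict (unitCell n)

/-- The normalized Haar measure of the torus `(ℝ/ℤ)^n`. -/
abbrev torusMeasure (n : ℕ) : Measure (UnitAddTorus (Fin n)) :=
  Measure.pi fun _ => AddCircle.haarAddCircle

/-- The covering map `ℝ^n → (ℝ/ℤ)^n`. -/
def toTorus (x : Fin n → ℝ) : UnitAddTorus (Fin n) := fun i => (x i : UnitAddCircle)

/-- The section of the covering map with values in `(0,1]^n`. -/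
def ofTorus (y : UnitAddTorus (Fin n)) : Fin n → ℝ :=
  fun i => (AddCircle.measurableEquivIoc 1 0 (y i) : ℝ)

theorem measurableSet_unitCell : MeasurableSet (unitCell n) :=
  MeasurableSet.univ_pi fun _ => measurableSet_Ioo

theorem unitCell_ae_eq_Icc : unitCell n =ᵐ[volume] Set.Icc (0 : Fin n → ℝ) 1 :=
  Measure.univ_pi_Ioo_ae_eq_Icc (f := fun _ => (0 : ℝ)) (g := fun _ => 1)

instance isProbabilityMeasure_cellMeasure : IsProbabilityMeasure (cellMeasure n) :=
  ⟨by simp [unitCell, Real.volume_pi_Ioo]⟩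

theorem integrable_cellMeasure_of_continuous {E : Type*} [NormedAddCommGroup E]
    {f : (Fin n → ℝ) → E} (hf : Continuous f) : Integrable f (cellMeasure n) := by
  rw [cellMeasure, Measure.restrict_congr_set unitCell_ae_eq_Icc]
  exact hf.continuousOn.integrableOn_compact isCompact_Icc

theorem memLp_two_cellMeasure_of_continuous {φ : (Fin n → ℝ) → ℝ} (hφ : Continuous φ) :
    MemLp φ 2 (cellMeasure n) :=
  (memLp_two_iff_integrable_sq hφ.aestronglyMeasurable).2
    (integrable_cellMeasure_of_continuous (hφ.pow 2))

theorem inner_eq_integral (u v : L2per n) : inner ℝ u v = ∫ x in unitCell n, u x * v x := by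
  rw [L2.inner_def]
  exact integral_congr_ae (.of_forall fun x => mul_comm _ _)

theorem inner_toLp (u : L2per n) {φ : (Fin n → ℝ) → ℝ} (hφ : MemLp φ 2 (cellMeasure n)) :
    inner ℝ u (hφ.toLp φ) = ∫ x in unitCell n, u x * φ x := by
  rw [inner_eq_integral]
  refine integral_congr_ae ?_
  filter_upwards [hφ.coeFn_toLp] with x hx
  rw [hx]

/-! ### Fourier coefficients -/

theorem measurePreserving_toTorus :
    MeasurePreserving toTorus (cellMeasure n) (torusMeasure n) := by
  have hmk : MeasurePreserving (QuotientAddGroup.mk : ℝ → UnitAddCircle)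
      (volume.restrict (Set.Ioo (0 : ℝ) 1)) AddCircle.haarAddCircle := by
    simpa only [AddCircle.volume_eq_smul_haarAddCircle, ENNReal.ofReal_one, one_smul, zero_add,
      ← Measure.restrict_congr_set Ioo_ae_eq_Ioc] using AddCircle.measurePreserving_mk (1 : ℝ) 0
  have hpi := measurePreserving_pi (fun _ : Fin n => volume.restrict (Set.Ioo (0 : ℝ) 1))
    (fun _ => AddCircle.haarAddCircle) (fun _ => hmk)
  rwa [← Measure.restrict_pi_pi] at hpi

theorem ofTorus_toTorus_ae : ∀ᵐ x ∂cellMeasure n, ofTorus (toTorus x) = x := by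
  refine (ae_restrict_iff' measurableSet_unitCell).2 (.of_forall fun x hx => funext fun i => ?_)
  have hi : x i ∈ Set.Ioo (0 : ℝ) 1 := hx i (Set.mem_univ i)
  exact AddCircle.equivIoc_coe_of_mem (p := (1 : ℝ)) (a := 0)
    (by rw [zero_add]; exact ⟨hi.1, hi.2.le⟩)

theorem measurePreserving_ofTorus :
    MeasurePreserving ofTorus (torusMeasure n) (cellMeasure n) := by
  have hmeas : Measurable (ofTorus (n := n)) :=
    measurable_pi_lambda _ fun i => measurable_subtype_coe.comp
      ((AddCircle.measurableEquivIoc 1 0).measurable.comp (measurable_pi_apply i))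
  refine ⟨hmeas, ?_⟩
  rw [← measurePreserving_toTorus.map_eq,
    Measure.map_map hmeas measurePreserving_toTorus.measurable]
  exact (Measure.map_congr ofTorus_toTorus_ae).trans Measure.map_id

/-- Pulling back along the covering map identifies `L²` of the torus with `L²(Y;ℂ)`. -/
def torusToCell (n : ℕ) : Lp ℂ 2 (torusMeasure n) ≃ₗᵢ[ℂ] Lp ℂ 2 (cellMeasure n) :=
  LinearIsometryEquiv.ofSurjective
    (Lp.compMeasurePreservingₗᵢ ℂ toTorus measurePreserving_toTorus) fun v => by
      refine ⟨Lp.compMeasurePreserving ofTorus measurePreserving_ofTorus v, Lp.ext ?_⟩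
      have hpull := measurePreserving_toTorus.quasiMeasurePreserving.ae_eq_comp
        (Lp.coeFn_compMeasurePreserving v measurePreserving_ofTorus)
      refine ((Lp.coeFn_compMeasurePreserving _ measurePreserving_toTorus).trans hpull).trans ?_
      filter_upwards [ofTorus_toTorus_ae] with x hx
      simp only [Function.comp_apply, hx]

/-- The Fourier basis of `L²(Y;ℂ)`. -/
def cellBasis (n : ℕ) : HilbertBasis (Fin n → ℤ) ℂ (Lp ℂ 2 (cellMeasure n)) :=
  HilbertBasis.ofRepr ((torusToCell n).symm.trans UnitAddTorus.mFourierBasis.repr)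

/-- The character `x ↦ exp(2πi k·x)` of `ℝ^n`. -/
def character (k : Fin n → ℤ) (x : Fin n → ℝ) : ℂ :=
  Complex.exp (2 * Real.pi * Complex.I * ((∑ j, (k j : ℝ) * x j : ℝ) : ℂ))

theorem mFourier_toTorus (k : Fin n → ℤ) (x : Fin n → ℝ) :
    UnitAddTorus.mFourier k (toTorus x) = character k x := by
  simp only [UnitAddTorus.mFourier, ContinuousMap.coe_mk, toTorus, fourier_coe_apply, character,
    ← Complex.exp_sum]
  push_cast
  rw [Finset.mul_sum]
  exact congrArg _ (Finset.sum_congr rfl fun j _ => by ring)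

theorem character_zero (x : Fin n → ℝ) : character 0 x = 1 := by simp [character]

theorem character_neg (k : Fin n → ℤ) (x : Fin n → ℝ) :
    character (-k) x = conj (character k x) := by
  rw [← mFourier_toTorus, UnitAddTorus.mFourier_neg, mFourier_toTorus]

theorem character_add_single (k : Fin n → ℤ) (i : Fin n) (x : Fin n → ℝ) :
    character k (x + Pi.single i 1) = character k x := by
  rw [← mFourier_toTorus, ← mFourier_toTorus]
  congr 1
  funext j
  obtain rfl | hj := eq_or_ne j i
  · simp [toTorus]
  · simp [toTorus, Pi.single_eq_of_ne hj]

theorem contDiff_character (k : Fin n → ℤ) {m : WithTop ℕ∞} : ContDiff ℝ m (character k) := by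
  have h : ContDiff ℝ m fun x : Fin n → ℝ => ∑ j, (k j : ℝ) * x j := by fun_prop
  exact (contDiff_const.mul (Complex.ofRealCLM.contDiff.comp h)).cexp

theorem fderiv_character (k : Fin n → ℤ) (x : Fin n → ℝ) (i : Fin n) :
    fderiv ℝ (character k) x (Pi.single i 1) = 2 * Real.pi * Complex.I * k i * character k x := by
  let phase : (Fin n → ℝ) →L[ℝ] ℝ := ∑ j, (k j : ℝ) • ContinuousLinearMap.proj j
  have hphase (y : Fin n → ℝ) : phase y = ∑ j, (k j : ℝ) * y j := by simp [phase]
  have hd := ((Complex.ofRealCLM.comp phase).hasFDerivAt (x := x)).const_mul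
    (2 * Real.pi * Complex.I : ℂ) |>.cexp
  have hchar : character k = fun y => Complex.exp (2 * Real.pi * Complex.I *
      Complex.ofRealCLM.comp phase y) := by
    funext y
    simp [character, hphase]
  rw [hchar, hd.fderiv]
  simp [hphase, Pi.single_apply]
  ring

theorem coeFn_cellBasis (k : Fin n → ℤ) : cellBasis n k =ᵐ[cellMeasure n] character k := by
  have h : cellBasis n k = torusToCell n (UnitAddTorus.mFourierLp 2 k) := by
    rw [← UnitAddTorus.coe_mFourierBasis]
    rfl
  rw [h]
  refine (Lp.coeFn_compMeasurePreserving _ measurePreserving_toTorus).trans ?_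
  refine (measurePreserving_toTorus.quasiMeasurePreserving.ae_eq_comp
    (UnitAddTorus.coeFn_mFourierLp 2 k)).trans ?_
  exact .of_forall (mFourier_toTorus k)

theorem inner_cellBasis (f : Lp ℂ 2 (cellMeasure n)) (k : Fin n → ℤ) :
    inner ℂ (cellBasis n k) f = ∫ x in unitCell n, f x * conj (character k x) := by
  rw [L2.inner_def]
  refine integral_congr_ae ?_
  filter_upwards [coeFn_cellBasis k] with x hx
  rw [hx, RCLike.inner_apply]

theorem inner_cellBasis_star (f : Lp ℂ 2 (cellMeasure n)) (k : Fin n → ℤ) :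
    inner ℂ (cellBasis n k) (star f) = conj (inner ℂ (cellBasis n (-k)) f) := by
  rw [inner_cellBasis, inner_cellBasis, ← integral_conj]
  refine integral_congr_ae ?_
  filter_upwards [Lp.coeFn_star f] with x hx
  simp [hx, character_neg]

/-- The inclusion of `L²(Y)` into `L²(Y;ℂ)`. -/
def complexify (n : ℕ) : L2per n →L[ℝ] Lp ℂ 2 (cellMeasure n) :=
  Complex.ofRealCLM.compLpL 2 (cellMeasure n)

theorem coeFn_complexify (u : L2per n) : complexify n u =ᵐ[cellMeasure n] fun x => (u x : ℂ) :=
  ContinuousLinearMap.coeFn_compLpL _ u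

theorem star_complexify (u : L2per n) : star (complexify n u) = complexify n u := by
  refine Lp.ext ?_
  filter_upwards [Lp.coeFn_star (complexify n u), coeFn_complexify u] with x hstar hx
  simp [hstar, hx]

theorem inner_complexify (u v : L2per n) :
    inner ℂ (complexify n u) (complexify n v) = ((inner ℝ u v : ℝ) : ℂ) := by
  rw [L2.inner_def, L2.inner_def, ← integral_complex_ofReal]
  refine integral_congr_ae ?_
  filter_upwards [coeFn_complexify u, coeFn_complexify v] with x hu hv
  simp [hu, hv, RCLike.inner_apply]

theorem complexify_re (f : Lp ℂ 2 (cellMeasure n)) :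
    complexify n (Complex.reCLM.compLp f) = (2⁻¹ : ℂ) • (f + star f) := by
  refine Lp.ext ?_
  filter_upwards [coeFn_complexify (Complex.reCLM.compLp f),
    ContinuousLinearMap.coeFn_compLp Complex.reCLM f, Lp.coeFn_smul (2⁻¹ : ℂ) (f + star f),
    Lp.coeFn_add f (star f), Lp.coeFn_star f] with x hc hre hsmul hadd hstar
  simp only [hc, hre, hsmul, hadd, hstar, Pi.smul_apply, Pi.add_apply, Pi.star_apply,
    Complex.reCLM_apply, Complex.re_eq_add_conj, smul_eq_mul, RCLike.star_def]
  ring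

/-- The Fourier coefficient `∫_Y u(x) exp(-2πi k·x) dx` of a real function. -/
def coeff (k : Fin n → ℤ) : L2per n →L[ℝ] ℂ :=
  ((innerSL ℂ (cellBasis n k)).restrictScalars ℝ).comp (complexify n)

theorem coeff_apply (k : Fin n → ℤ) (u : L2per n) :
    coeff k u = inner ℂ (cellBasis n k) (complexify n u) := rfl

theorem coeff_eq_integral (k : Fin n → ℤ) (u : L2per n) :
    coeff k u = ∫ x in unitCell n, (u x : ℂ) * conj (character k x) := by
  rw [coeff_apply, inner_cellBasis]
  refine integral_congr_ae ?_
  filter_upwards [coeFn_complexify u] with x hx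
  rw [hx]

theorem coeff_zero_eq_integral (u : L2per n) :
    coeff 0 u = ((∫ x in unitCell n, u x : ℝ) : ℂ) := by
  rw [coeff_eq_integral, ← integral_complex_ofReal]
  simp [character_zero]

theorem coeff_neg (k : Fin n → ℤ) (u : L2per n) : coeff (-k) u = conj (coeff k u) := by
  rw [coeff_apply, coeff_apply, ← star_complexify, inner_cellBasis_star, star_complexify, neg_neg]

theorem hasSum_conj_coeff_mul_coeff (u v : L2per n) :
    HasSum (fun k => conj (coeff k u) * coeff k v) ((inner ℝ u v : ℝ) : ℂ) := by
  simpa only [inner_complexify, coeff_apply, inner_conj_symm] using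
    (cellBasis n).hasSum_inner_mul_inner (complexify n u) (complexify n v)

theorem hasSum_norm_coeff_sq (u : L2per n) :
    HasSum (fun k => ‖coeff k u‖ ^ 2) (‖u‖ ^ 2) := by
  rw [← real_inner_self_eq_norm_sq]
  refine Complex.hasSum_ofReal.1 ((hasSum_conj_coeff_mul_coeff u u).congr_fun fun k => ?_)
  rw [mul_comm, Complex.mul_conj, Complex.normSq_eq_norm_sq]

theorem ext_coeff {u v : L2per n} (h : ∀ k, coeff k u = coeff k v) : u = v := by
  have hzero : HasSum (fun _ : Fin n → ℤ => (0 : ℝ)) (‖u - v‖ ^ 2) :=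
    (hasSum_norm_coeff_sq (u - v)).congr_fun fun k => by simp [h k]
  rw [← sub_eq_zero, ← norm_eq_zero]
  exact pow_eq_zero_iff two_ne_zero |>.1 (hzero.unique hasSum_zero)

theorem exists_coeff_eq {a : (Fin n → ℤ) → ℂ} (ha : Summable fun k => ‖a k‖ ^ 2)
    (hconj : ∀ k, a (-k) = conj (a k)) : ∃ u : L2per n, ∀ k, coeff k u = a k := by
  let f : Lp ℂ 2 (cellMeasure n) :=
    (cellBasis n).repr.symm ⟨a, memℓp_gen (by simpa using ha)⟩
  have hf (k) : inner ℂ (cellBasis n k) f = a k := by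
    rw [← HilbertBasis.repr_apply_apply, LinearIsometryEquiv.apply_symm_apply]
  refine ⟨Complex.reCLM.compLp f, fun k => ?_⟩
  rw [coeff_apply, complexify_re, inner_smul_right, inner_add_right, inner_cellBasis_star, hf, hf,
    hconj, Complex.conj_conj]
  ring

theorem exists_coeff_eq_of_norm_le {a : (Fin n → ℤ) → ℂ} (q : L2per n)
    (ha : ∀ k, ‖a k‖ ≤ ‖coeff k q‖) (hconj : ∀ k, a (-k) = conj (a k)) :
    ∃ u : L2per n, ∀ k, coeff k u = a k :=
  exists_coeff_eq ((hasSum_norm_coeff_sq q).summable.of_nonneg_of_le (fun _ => by positivity)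
    fun k => by gcongr; exact ha k) hconj

/-! ### Weak derivatives in Fourier space -/

theorem integral_fderiv_single_eq_zero {E : Type*} [NormedAddCommGroup E] [NormedSpace ℝ E]
    {F : (Fin n → ℝ) → E} (hF : ContDiff ℝ 1 F) (i : Fin n)
    (hper : ∀ x, F (x + Pi.single i 1) = F x) :
    ∫ x in unitCell n, fderiv ℝ F x (Pi.single i 1) = 0 := by
  obtain _ | m := n
  · exact i.elim0
  have hsum (x : Fin (m + 1) → ℝ) :
      ∑ j, (if j = i then fderiv ℝ F x else 0) (Pi.single j 1) =
        fderiv ℝ F x (Pi.single i 1) := by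
    rw [Finset.sum_eq_single i (fun j _ hj => by simp [hj]) (by simp), if_pos rfl]
  have hcont : Continuous fun x => fderiv ℝ F x (Pi.single i 1) :=
    (hF.continuous_fderiv one_ne_zero).clm_apply continuous_const
  have hdiv := integral_divergence_of_hasFDerivAt_off_countable' (0 : Fin (m + 1) → ℝ) 1
    (fun _ => zero_le_one) (fun j x => if j = i then F x else 0)
    (fun j x => if j = i then fderiv ℝ F x else 0) ∅ Set.countable_empty
    (fun j => by split_ifs; exacts [hF.continuous.continuousOn, continuousOn_const])
    (fun x _ j => by
      split_ifs
      exacts [(hF.differentiable one_ne_zero x).hasFDerivAt, hasFDerivAt_const _ _])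
    (by simpa only [hsum] using hcont.continuousOn.integrableOn_compact isCompact_Icc)
  simp only [hsum] at hdiv
  rw [setIntegral_congr_set unitCell_ae_eq_Icc, hdiv]
  refine Finset.sum_eq_zero fun j _ => sub_eq_zero.2 (integral_congr_ae (.of_forall fun x => ?_))
  have hface : (j.insertNth 1 x : Fin (m + 1) → ℝ) = j.insertNth 0 x + Pi.single j 1 := by
    funext l
    refine Fin.succAboveCases j ?_ (fun l => ?_) l <;> simp [Fin.succAbove_ne]
  by_cases hj : j = i
  · subst hj
    simp only [if_true, Pi.one_apply, Pi.zero_apply, hface, hper]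
  · simp only [if_neg hj]

theorem IsSmoothPeriodic.integral_mul_partialDeriv {φ ψ : (Fin n → ℝ) → ℝ}
    (hφ : IsSmoothPeriodic φ) (hψ : IsSmoothPeriodic ψ) (i : Fin n) :
    ∫ x in unitCell n, φ x * partialDeriv i ψ x =
      - ∫ x in unitCell n, partialDeriv i φ x * ψ x := by
  have hd (x) : fderiv ℝ (fun y => φ y * ψ y) x (Pi.single i 1) =
      φ x * partialDeriv i ψ x + partialDeriv i φ x * ψ x := by
    rw [fderiv_fun_mul (hφ.smooth.differentiable (by simp) x)
      (hψ.smooth.differentiable (by simp) x)]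
    simp [partialDeriv, mul_comm]
  have hzero := integral_fderiv_single_eq_zero ((hφ.smooth.mul hψ.smooth).of_le (by norm_cast)) i
    fun x => by simp only [hφ.periodic, hψ.periodic]
  have hφψ' : Integrable (fun x => φ x * partialDeriv i ψ x) (cellMeasure n) :=
    integrable_cellMeasure_of_continuous
      (hφ.smooth.continuous.mul (hψ.continuous_partialDeriv i))
  have hφ'ψ : Integrable (fun x => partialDeriv i φ x * ψ x) (cellMeasure n) :=
    integrable_cellMeasure_of_continuous
      ((hφ.continuous_partialDeriv i).mul hψ.smooth.continuous)
  simp only [hd] at hzero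
  rw [integral_add hφψ' hφ'ψ] at hzero
  exact eq_neg_of_add_eq_zero_left hzero

theorem IsSmoothPeriodic.isWeakPartial_toLp {φ : (Fin n → ℝ) → ℝ} (hφ : IsSmoothPeriodic φ)
    (i : Fin n) :
    IsWeakPartial i ((memLp_two_cellMeasure_of_continuous hφ.smooth.continuous).toLp φ)
      ((memLp_two_cellMeasure_of_continuous (hφ.continuous_partialDeriv i)).toLp
        (partialDeriv i φ)) := by
  intro ψ hψ
  have hcongr {f : (Fin n → ℝ) → ℝ} (hf : MemLp f 2 (cellMeasure n)) (g : (Fin n → ℝ) → ℝ) :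
      ∫ x in unitCell n, hf.toLp f x * g x = ∫ x in unitCell n, f x * g x :=
    integral_congr_ae (by filter_upwards [hf.coeFn_toLp] with x hx; rw [hx])
  rw [hcongr, hcongr, hφ.integral_mul_partialDeriv hψ]

theorem integrable_ofReal_mul_continuous (u : L2per n) {c : (Fin n → ℝ) → ℂ}
    (hc : Continuous c) : Integrable (fun x => (u x : ℂ) * c x) (cellMeasure n) := by
  refine ((integrable_mul_continuous u (Complex.continuous_re.comp hc)).ofReal.add
    ((integrable_mul_continuous u (Complex.continuous_im.comp hc)).ofReal.mul_const
      Complex.I)).congr (.of_forall fun x => ?_)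
  apply Complex.ext <;> simp

theorem IsWeakPartial.integral_mul_fderiv {i : Fin n} {u g : L2per n} (h : IsWeakPartial i u g)
    {c : (Fin n → ℝ) → ℂ} (hc : ContDiff ℝ ∞ c)
    (hper : ∀ (j : Fin n) (x : Fin n → ℝ), c (x + Pi.single j 1) = c x) :
    ∫ x in unitCell n, (u x : ℂ) * fderiv ℝ c x (Pi.single i 1) =
      - ∫ x in unitCell n, (g x : ℂ) * c x := by
  have hc' : Continuous fun x => fderiv ℝ c x (Pi.single i 1) :=
    (hc.continuous_fderiv (by simp)).clm_apply continuous_const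
  have test (L : ℂ →L[ℝ] ℝ) :
      L (∫ x in unitCell n, (u x : ℂ) * fderiv ℝ c x (Pi.single i 1)) =
        L (- ∫ x in unitCell n, (g x : ℂ) * c x) := by
    have hmul (a : ℝ) (z : ℂ) : L (a * z) = a * L z := by
      rw [← smul_eq_mul (a : ℂ), Complex.coe_smul, map_smul, smul_eq_mul]
    have hL (x) : partialDeriv i (fun y => L (c y)) x = L (fderiv ℝ c x (Pi.single i 1)) := by
      have hd := L.hasFDerivAt.comp x (hc.differentiable (by simp) x).hasFDerivAt
      exact congrArg (fun T : (Fin n → ℝ) →L[ℝ] ℝ => T (Pi.single i 1)) hd.fderiv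
    rw [map_neg, ← L.integral_comp_comm (integrable_ofReal_mul_continuous u hc'),
      ← L.integral_comp_comm (integrable_ofReal_mul_continuous g hc.continuous)]
    simp only [hmul, ← hL]
    exact h _ ⟨L.contDiff.comp hc, fun j x => by rw [hper]⟩
  exact Complex.ext (test Complex.reCLM) (test Complex.imCLM)

theorem IsWeakPartial.coeff_eq {i : Fin n} {u g : L2per n} (h : IsWeakPartial i u g)
    (k : Fin n → ℤ) : coeff k g = 2 * Real.pi * Complex.I * k i * coeff k u := by
  have hk := h.integral_mul_fderiv (contDiff_character (-k)) (character_add_single (-k))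
  simp only [fderiv_character, character_neg] at hk
  rw [coeff_eq_integral, coeff_eq_integral, ← integral_const_mul, ← neg_eq_iff_eq_neg.2 hk,
    ← integral_neg]
  refine integral_congr_ae (.of_forall fun x => ?_)
  simp only [Pi.neg_apply, Int.cast_neg]
  ring

theorem isWeakPartial_iff_coeff {i : Fin n} {u g : L2per n} :
    IsWeakPartial i u g ↔ ∀ k, coeff k g = 2 * Real.pi * Complex.I * k i * coeff k u := by
  refine ⟨IsWeakPartial.coeff_eq, fun h φ hφ => ?_⟩
  have hφ0 := memLp_two_cellMeasure_of_continuous hφ.smooth.continuous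
  have hφ1 := memLp_two_cellMeasure_of_continuous (hφ.continuous_partialDeriv i)
  rw [← inner_toLp u hφ1, ← inner_toLp g hφ0]
  apply Complex.ofReal_injective
  rw [Complex.ofReal_neg]
  refine (hasSum_conj_coeff_mul_coeff u (hφ1.toLp _)).unique
    ((hasSum_conj_coeff_mul_coeff g (hφ0.toLp _)).neg.congr_fun fun k => ?_)
  rw [(hφ.isWeakPartial_toLp i).coeff_eq, h k]
  simp only [map_mul, Complex.conj_I, Complex.conj_ofReal, map_ofNat, map_intCast]
  ring

theorem IsWeakPartial.unique {i : Fin n} {u g g' : L2per n} (h : IsWeakPartial i u g)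
    (h' : IsWeakPartial i u g') : g = g' :=
  ext_coeff fun k => by rw [h.coeff_eq, h'.coeff_eq]

theorem IsWeakPartial.integral_eq_zero {i : Fin n} {u g : L2per n} (h : IsWeakPartial i u g) :
    ∫ x in unitCell n, g x = 0 := by
  have h0 := h.coeff_eq 0
  rw [coeff_zero_eq_integral] at h0
  simpa using h0

theorem IsWeakPartial.partial_comm {i j : Fin n} {u p q r : L2per n} (hp : IsWeakPartial i u p)
    (hq : IsWeakPartial j u q) (hr : IsWeakPartial i q r) : IsWeakPartial j p r :=
  isWeakPartial_iff_coeff.2 fun k => by rw [hr.coeff_eq, hq.coeff_eq, hp.coeff_eq]; ring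

theorem IsWeakPartial.inner_swap {i j : Fin n} {u v ui uj vi vj : L2per n}
    (hui : IsWeakPartial i u ui) (huj : IsWeakPartial j u uj) (hvi : IsWeakPartial i v vi)
    (hvj : IsWeakPartial j v vj) : (inner ℝ ui vj : ℝ) = inner ℝ uj vi := by
  apply Complex.ofReal_injective
  refine (hasSum_conj_coeff_mul_coeff ui vj).unique
    ((hasSum_conj_coeff_mul_coeff uj vi).congr_fun fun k => ?_)
  rw [hui.coeff_eq, huj.coeff_eq, hvi.coeff_eq, hvj.coeff_eq]
  simp only [map_mul, map_intCast]
  ring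

theorem isClosed_isWeakPartial (i : Fin n) :
    IsClosed {q : L2per n × L2per n | IsWeakPartial i q.1 q.2} := by
  simp only [isWeakPartial_iff_coeff, Set.ofPred_forall]
  exact isClosed_iInter fun k => isClosed_eq (by fun_prop) (by fun_prop)

theorem IsWeakPartial.norm_coeff {i : Fin n} {u g : L2per n} (h : IsWeakPartial i u g)
    (k : Fin n → ℤ) : ‖coeff k g‖ = |2 * Real.pi * k i| * ‖coeff k u‖ := by
  rw [h.coeff_eq]
  simp [abs_mul]

/-- The Fourier symbol `|2πk|²` of `-Δ`. -/
def laplaceSymbol (k : Fin n → ℤ) : ℝ := ∑ j, (2 * Real.pi * k j) ^ 2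

theorem laplaceSymbol_nonneg (k : Fin n → ℤ) : 0 ≤ laplaceSymbol k :=
  Finset.sum_nonneg fun _ _ => sq_nonneg _

theorem laplaceSymbol_neg (k : Fin n → ℤ) : laplaceSymbol (-k) = laplaceSymbol k := by
  simp [laplaceSymbol]

theorem sq_le_laplaceSymbol (k : Fin n → ℤ) (i : Fin n) :
    (2 * Real.pi * k i) ^ 2 ≤ laplaceSymbol k :=
  Finset.single_le_sum (f := fun j => (2 * Real.pi * k j) ^ 2) (fun _ _ => sq_nonneg _)
    (Finset.mem_univ i)

theorem four_pi_sq_le_laplaceSymbol {k : Fin n → ℤ} (hk : k ≠ 0) :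
    4 * Real.pi ^ 2 ≤ laplaceSymbol k := by
  obtain ⟨j, hj⟩ := Function.ne_iff.1 hk
  have hj' : (1 : ℝ) ≤ (k j : ℝ) ^ 2 := by
    exact_mod_cast Int.add_one_le_of_lt (sq_pos_of_ne_zero hj)
  refine le_trans ?_ (sq_le_laplaceSymbol k j)
  nlinarith [sq_nonneg Real.pi]

theorem poincare {u : L2per n} {g : Fin n → L2per n} (h : ∀ j, IsWeakPartial j u (g j))
    (hu : ∫ x in unitCell n, u x = 0) : 4 * Real.pi ^ 2 * ‖u‖ ^ 2 ≤ ∑ j, ‖g j‖ ^ 2 := by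
  refine hasSum_le (fun k => ?_) ((hasSum_norm_coeff_sq u).mul_left (4 * Real.pi ^ 2))
    (hasSum_sum fun j _ => hasSum_norm_coeff_sq (g j))
  simp only [(h _).norm_coeff, mul_pow |_|, sq_abs, ← Finset.sum_mul]
  obtain rfl | hk := eq_or_ne k 0
  · simp [coeff_zero_eq_integral, hu]
  · gcongr
    exact four_pi_sq_le_laplaceSymbol hk

/-! ### The space `H¹_{per,0}` -/

theorem isWeakPartial_grad (v : H1perZero n) (i j : Fin n) :
    IsWeakPartial j (comp v i) (grad v i j) := v.2.1 i j

theorem integral_comp_eq_zero (v : H1perZero n) (i : Fin n) :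
    ∫ x in unitCell n, comp v i x = 0 := v.2.2 i

theorem norm_sq_H1perZero (v : H1perZero n) :
    ‖v‖ ^ 2 = ∑ i, ‖comp v i‖ ^ 2 + ∑ i, ∑ j, ‖grad v i j‖ ^ 2 := by
  rw [Submodule.coe_norm, WithLp.prod_norm_sq_eq_of_L2, PiLp.norm_sq_eq_of_L2,
    PiLp.norm_sq_eq_of_L2, Fintype.sum_prod_type]
  rfl

instance completeSpace_H1perZero : CompleteSpace (H1perZero n) := by
  have hset : (H1perZero n : Set (FieldWithGrad n)) =
      (⋂ (i) (j), {u | IsWeakPartial j (u.fst i) (u.snd (i, j))}) ∩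
        ⋂ i, {u | coeff 0 (u.fst i) = 0} := by
    ext u
    simp only [Set.mem_inter_iff, Set.mem_iInter, Set.mem_ofPred_eq, coeff_zero_eq_integral,
      Complex.ofReal_eq_zero]
    rfl
  suffices hclosed : IsClosed (H1perZero n : Set (FieldWithGrad n)) from
    hclosed.completeSpace_coe
  rw [hset]
  refine (isClosed_iInter fun i => isClosed_iInter fun j => ?_).inter
    (isClosed_iInter fun i => isClosed_eq (by fun_prop) continuous_const)
  exact (isClosed_isWeakPartial j).preimage
    (f := fun u : FieldWithGrad n => (u.fst i, u.snd (i, j))) (by fun_prop)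

/-- The component `v ↦ v_i` as a continuous linear map. -/
def compCLM (i : Fin n) : H1perZero n →L[ℝ] L2per n :=
  (PiLp.proj 2 (fun _ : Fin n => L2per n) i).comp
    ((WithLp.fstL 2 ℝ _ _).comp (H1perZero n).subtypeL)

/-- The partial derivative `v ↦ ∂_j v_i` as a continuous linear map. -/
def gradCLM (i j : Fin n) : H1perZero n →L[ℝ] L2per n :=
  (PiLp.proj 2 (fun _ : Fin n × Fin n => L2per n) (i, j)).comp
    ((WithLp.sndL 2 ℝ _ _).comp (H1perZero n).subtypeL)

theorem compCLM_apply (i : Fin n) (v : H1perZero n) : compCLM i v = comp v i := rfl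

theorem gradCLM_apply (i j : Fin n) (v : H1perZero n) : gradCLM i j v = grad v i j := rfl

/-- The divergence as a continuous linear map into `L²_per(Y)`. -/
def divCLM (n : ℕ) : H1perZero n →L[ℝ] L2per n := ∑ i, gradCLM i i

theorem divCLM_apply (v : H1perZero n) : divCLM n v = ∑ i, grad v i i := by
  simp [divCLM, gradCLM_apply]

theorem coeFn_divCLM (v : H1perZero n) : divCLM n v =ᵐ[cellMeasure n] div v := by
  rw [divCLM_apply]
  filter_upwards [Lp.coeFn_fun_finsetSum Finset.univ fun i => grad v i i] with x hx
  rw [hx, div]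

theorem integral_divCLM (v : H1perZero n) : ∫ x in unitCell n, divCLM n v x = 0 := by
  apply Complex.ofReal_injective
  rw [← coeff_zero_eq_integral, divCLM_apply, map_sum, Complex.ofReal_zero]
  refine Finset.sum_eq_zero fun i _ => ?_
  rw [coeff_zero_eq_integral, (isWeakPartial_grad v i i).integral_eq_zero, Complex.ofReal_zero]

theorem norm_sq_divCLM (v : H1perZero n) :
    ‖divCLM n v‖ ^ 2 = ∑ i, ∑ j, inner ℝ (grad v i j) (grad v j i) := by
  rw [divCLM_apply, ← real_inner_self_eq_norm_sq, sum_inner]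
  simp only [inner_sum]
  refine Finset.sum_congr rfl fun i _ => Finset.sum_congr rfl fun j _ => ?_
  exact (isWeakPartial_grad v i i).inner_swap (isWeakPartial_grad v i j)
    (isWeakPartial_grad v j i) (isWeakPartial_grad v j j)

theorem half_sum_norm_sq_grad_sub (v : H1perZero n) :
    (1 / 2) * ∑ i, ∑ j, ‖grad v i j - grad v j i‖ ^ 2 =
      (∑ i, ∑ j, ‖grad v i j‖ ^ 2) - ‖divCLM n v‖ ^ 2 := by
  have htranspose : ∑ i, ∑ j, ‖grad v j i‖ ^ 2 = ∑ i, ∑ j, ‖grad v i j‖ ^ 2 := Finset.sum_comm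
  simp only [norm_sub_sq_real, Finset.sum_add_distrib, Finset.sum_sub_distrib, ← Finset.mul_sum,
    htranspose, ← norm_sq_divCLM]
  ring

theorem norm_divCLM_sq_le (v : H1perZero n) :
    ‖divCLM n v‖ ^ 2 ≤ ∑ i, ∑ j, ‖grad v i j‖ ^ 2 := by
  rw [← sub_nonneg, ← half_sum_norm_sq_grad_sub]
  positivity

theorem four_pi_sq_mul_norm_sq_le (v : H1perZero n) :
    4 * Real.pi ^ 2 * ‖v‖ ^ 2 ≤ (1 + 4 * Real.pi ^ 2) * ∑ i, ∑ j, ‖grad v i j‖ ^ 2 := by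
  have h : 4 * Real.pi ^ 2 * ∑ i, ‖comp v i‖ ^ 2 ≤ ∑ i, ∑ j, ‖grad v i j‖ ^ 2 := by
    rw [Finset.mul_sum]
    exact Finset.sum_le_sum fun i _ =>
      poincare (fun j => isWeakPartial_grad v i j) (integral_comp_eq_zero v i)
  rw [norm_sq_H1perZero]
  linarith

/-! ### Gradient fields and the periodic Poisson problem -/

theorem exists_isWeakPartial_of_norm_coeff_le {i : Fin n} {u : L2per n} (q : L2per n)
    (h : ∀ k, |2 * Real.pi * k i| * ‖coeff k u‖ ≤ ‖coeff k q‖) :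
    ∃ g : L2per n, IsWeakPartial i u g := by
  obtain ⟨g, hg⟩ := exists_coeff_eq_of_norm_le
    (a := fun k => 2 * Real.pi * Complex.I * k i * coeff k u) q
    (fun k => by simpa [abs_mul] using h k) (fun k => by
      simp only [Pi.neg_apply, Int.cast_neg, coeff_neg, map_mul, map_ofNat, Complex.conj_ofReal,
        Complex.conj_I, map_intCast]
      ring)
  exact ⟨g, isWeakPartial_iff_coeff.2 hg⟩

theorem inv_laplaceSymbol_le_one (k : Fin n → ℤ) : (laplaceSymbol k)⁻¹ ≤ 1 := by
  obtain rfl | hk := eq_or_ne k 0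
  · simp [laplaceSymbol]
  · exact inv_le_one_of_one_le₀ (by
      nlinarith [four_pi_sq_le_laplaceSymbol hk, Real.pi_gt_three])

theorem abs_mul_inv_laplaceSymbol_le_one (k : Fin n → ℤ) (i : Fin n) :
    |2 * Real.pi * k i| * (laplaceSymbol k)⁻¹ ≤ 1 := by
  have hnonneg : 0 ≤ (laplaceSymbol k)⁻¹ := inv_nonneg.2 (laplaceSymbol_nonneg k)
  rw [← sq_le_one_iff₀ (by positivity), mul_pow, sq_abs, sq (laplaceSymbol k)⁻¹, ← mul_assoc]
  exact mul_le_one₀ (mul_inv_le_one_of_le₀ (sq_le_laplaceSymbol k i) (laplaceSymbol_nonneg k))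
    hnonneg (inv_laplaceSymbol_le_one k)

theorem abs_mul_abs_mul_inv_laplaceSymbol_le_one (k : Fin n → ℤ) (i j : Fin n) :
    |2 * Real.pi * k j| * (|2 * Real.pi * k i| * (laplaceSymbol k)⁻¹) ≤ 1 := by
  rw [← mul_assoc, ← div_eq_mul_inv]
  refine div_le_one_of_le₀ ?_ (laplaceSymbol_nonneg k)
  nlinarith [sq_le_laplaceSymbol k i, sq_le_laplaceSymbol k j, sq_abs (2 * Real.pi * k i),
    sq_abs (2 * Real.pi * k j), sq_nonneg (|2 * Real.pi * k j| - |2 * Real.pi * k i|)]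

theorem coeff_laplacian {φ : L2per n} {p : Fin n → L2per n} {H : Fin n → Fin n → L2per n}
    (hp : ∀ i, IsWeakPartial i φ (p i)) (hH : ∀ i j, IsWeakPartial j (p i) (H i j))
    (k : Fin n → ℤ) : coeff k (∑ i, H i i) = -(laplaceSymbol k : ℂ) * coeff k φ := by
  rw [map_sum, laplaceSymbol, Complex.ofReal_sum, ← Finset.sum_neg_distrib, Finset.sum_mul]
  refine Finset.sum_congr rfl fun i _ => ?_
  rw [(hH i i).coeff_eq, (hp i).coeff_eq]
  push_cast
  linear_combination (4 * Real.pi ^ 2 * (k i : ℂ) ^ 2 * coeff k φ) * Complex.I_sq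

theorem exists_coeff_eq_neg_inv_laplaceSymbol_mul (q : L2per n) :
    ∃ φ : L2per n, ∀ k, coeff k φ = -((laplaceSymbol k)⁻¹ : ℝ) * coeff k q := by
  refine exists_coeff_eq_of_norm_le q (fun k => ?_) fun k => ?_
  · rw [norm_mul, norm_neg, Complex.norm_real,
      Real.norm_of_nonneg (inv_nonneg.2 (laplaceSymbol_nonneg k))]
    exact mul_le_of_le_one_left (norm_nonneg _) (inv_laplaceSymbol_le_one k)
  · simp only [laplaceSymbol_neg, coeff_neg, map_mul, map_neg, Complex.conj_ofReal]

theorem exists_laplacian_eq {q : L2per n} (hq : ∫ x in unitCell n, q x = 0) :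
    ∃ (φ : L2per n) (p : Fin n → L2per n) (H : Fin n → Fin n → L2per n),
      (∀ i, IsWeakPartial i φ (p i)) ∧ (∀ i j, IsWeakPartial j (p i) (H i j)) ∧
        ∑ i, H i i = q := by
  obtain ⟨φ, hφ⟩ := exists_coeff_eq_neg_inv_laplaceSymbol_mul q
  have hnorm (k) : ‖coeff k φ‖ = (laplaceSymbol k)⁻¹ * ‖coeff k q‖ := by
    rw [hφ, norm_mul, norm_neg, Complex.norm_real,
      Real.norm_of_nonneg (inv_nonneg.2 (laplaceSymbol_nonneg k))]
  choose p hp using fun i => exists_isWeakPartial_of_norm_coeff_le (i := i) (u := φ) q fun k => by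
    rw [hnorm, ← mul_assoc]
    exact mul_le_of_le_one_left (norm_nonneg _) (abs_mul_inv_laplaceSymbol_le_one k i)
  choose H hH using fun i j =>
    exists_isWeakPartial_of_norm_coeff_le (i := j) (u := p i) q fun k => by
      rw [(hp i).norm_coeff, hnorm, ← mul_assoc |2 * Real.pi * k i|, ← mul_assoc]
      exact mul_le_of_le_one_left (norm_nonneg _) (abs_mul_abs_mul_inv_laplaceSymbol_le_one k i j)
  refine ⟨φ, p, H, hp, hH, ext_coeff fun k => ?_⟩
  obtain rfl | hk := eq_or_ne k 0
  · rw [coeff_laplacian hp hH, coeff_zero_eq_integral q, hq]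
    simp [laplaceSymbol]
  · have hne : (laplaceSymbol k : ℂ) ≠ 0 := by
      rw [Complex.ofReal_ne_zero]
      nlinarith [four_pi_sq_le_laplaceSymbol hk, Real.pi_pos]
    rw [coeff_laplacian hp hH, hφ, neg_mul, neg_mul, mul_neg, neg_neg, Complex.ofReal_inv,
      mul_inv_cancel_left₀ hne]

/-- `v = ∇φ` for some `φ ∈ H²_per(Y)`. -/
def IsGradient (v : H1perZero n) : Prop := ∃ φ : L2per n, ∀ i, IsWeakPartial i φ (comp v i)

theorem IsGradient.grad_symm {v : H1perZero n} (hv : IsGradient v) (i j : Fin n) :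
    grad v i j = grad v j i := by
  obtain ⟨φ, hφ⟩ := hv
  exact (isWeakPartial_grad v i j).unique ((hφ i).partial_comm (hφ j) (isWeakPartial_grad v j i))

theorem exists_isGradient {φ : L2per n} {p : Fin n → L2per n} {H : Fin n → Fin n → L2per n}
    (hp : ∀ i, IsWeakPartial i φ (p i)) (hH : ∀ i j, IsWeakPartial j (p i) (H i j)) :
    ∃ v : H1perZero n, IsGradient v ∧ comp v = p ∧ grad v = H :=
  ⟨⟨WithLp.toLp 2 (WithLp.toLp 2 p, WithLp.toLp 2 fun ij => H ij.1 ij.2),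
    hH, fun i => (hp i).integral_eq_zero⟩, ⟨φ, hp⟩, rfl, rfl⟩

theorem exists_isGradient_divCLM_eq {q : L2per n} (hq : ∫ x in unitCell n, q x = 0) :
    ∃ v : H1perZero n, IsGradient v ∧ divCLM n v = q := by
  obtain ⟨φ, p, H, hp, hH, hsum⟩ := exists_laplacian_eq hq
  obtain ⟨v, hv, -, rfl⟩ := exists_isGradient hp hH
  exact ⟨v, hv, (divCLM_apply v).trans hsum⟩

/-! ### Coefficients close to the identity -/

section Pointwise

variable (A : (Fin n → ℝ) → Matrix (Fin n) (Fin n) ℝ) (b : (Fin n → ℝ) → Fin n → ℝ)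
  (x : Fin n → ℝ)

theorem sqNorm_nonneg : 0 ≤ sqNorm A b x := by
  rw [sqNorm]
  positivity

theorem sq_entry_le_sqNorm (i j : Fin n) : A x i j ^ 2 ≤ sqNorm A b x :=
  calc A x i j ^ 2 ≤ ∑ j, A x i j ^ 2 :=
        Finset.single_le_sum (fun j _ => sq_nonneg (A x i j)) (Finset.mem_univ j)
    _ ≤ ∑ i, ∑ j, A x i j ^ 2 :=
        Finset.single_le_sum (f := fun i => ∑ j, A x i j ^ 2) (fun i _ => by positivity)
          (Finset.mem_univ i)
    _ ≤ sqNorm A b x := le_add_of_nonneg_right (by positivity)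

theorem sq_drift_le_sqNorm (i : Fin n) : b x i ^ 2 ≤ sqNorm A b x :=
  calc b x i ^ 2 ≤ ∑ i, b x i ^ 2 :=
        Finset.single_le_sum (fun i _ => sq_nonneg (b x i)) (Finset.mem_univ i)
    _ ≤ sqNorm A b x := le_add_of_nonneg_left (by positivity)

theorem sq_firstOrderTerm_le (G : Fin n → Fin n → L2per n) (p : Fin n → L2per n) :
    firstOrderTerm A b G p x ^ 2 ≤
      sqNorm A b x * ((∑ i, ∑ j, G i j x ^ 2) + ∑ i, p i x ^ 2) := by
  have h := Finset.sum_mul_sq_le_sq_mul_sq (Finset.univ : Finset ((Fin n × Fin n) ⊕ Fin n))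
    (Sum.elim (fun ij => A x ij.1 ij.2) (b x)) (Sum.elim (fun ij => G ij.1 ij.2 x) (p · x))
  simpa only [Fintype.sum_sum_type, Fintype.sum_prod_type, Sum.elim_inl, Sum.elim_inr,
    firstOrderTerm, sqNorm] using h

theorem firstOrderTerm_sub_one (w : H1perZero n) :
    firstOrderTerm (fun y => A y - 1) b (grad w) (comp w) x =
      firstOrderTerm A b (grad w) (comp w) x - div w x := by
  simp only [firstOrderTerm, div, Matrix.sub_apply, Matrix.one_apply, sub_mul, ite_mul, one_mul,
    zero_mul, Finset.sum_sub_distrib, Finset.sum_ite_eq, Finset.mem_univ, if_true]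
  ring

theorem sqNorm_sub_one :
    sqNorm (fun y => A y - 1) b x = sqNorm A b x - 2 * (A x).trace + n := by
  have hentry (i j : Fin n) : (A x - 1) i j ^ 2 =
      A x i j ^ 2 + if i = j then 1 - 2 * A x i j else 0 := by
    rw [Matrix.sub_apply, Matrix.one_apply]
    split_ifs <;> ring
  simp only [sqNorm, hentry, Finset.sum_add_distrib, Finset.sum_ite_eq, Finset.mem_univ, if_true,
    Finset.sum_sub_distrib, ← Finset.mul_sum, Matrix.trace, Matrix.diag, Finset.sum_const,
    Finset.card_univ, Fintype.card_fin, nsmul_eq_mul, mul_one]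
  ring

theorem sqNorm_renorm :
    sqNorm (renormA A b) (renormb A b) x = (A x).trace ^ 2 / sqNorm A b x := by
  have hsmul : sqNorm (renormA A b) (renormb A b) x = gam A b x ^ 2 * sqNorm A b x := by
    simp only [sqNorm, renormA, renormb, Matrix.smul_apply, Pi.smul_apply, smul_eq_mul, mul_pow,
      ← Finset.mul_sum, mul_add]
  rw [hsmul, gam]
  obtain h | h := eq_or_ne (sqNorm A b x) 0
  · simp [h]
  · field_simp

theorem trace_renormA : (renormA A b x).trace = (A x).trace ^ 2 / sqNorm A b x := by
  rw [renormA, Matrix.trace_smul, gam, smul_eq_mul]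
  ring

theorem sqNorm_renorm_sub_one :
    sqNorm (fun y => renormA A b y - 1) (renormb A b) x =
      n - (A x).trace ^ 2 / sqNorm A b x := by
  rw [sqNorm_sub_one, sqNorm_renorm, trace_renormA]
  ring

theorem sqNorm_renorm_le : sqNorm (renormA A b) (renormb A b) x ≤ n := by
  have h := sqNorm_nonneg (fun y => renormA A b y - 1) (renormb A b) x
  rw [sqNorm_renorm_sub_one] at h
  rw [sqNorm_renorm]
  linarith

variable {A b x}

theorem sqNorm_renorm_sub_one_le {δ : ℝ} (hδ : 0 < δ) (htr : (A x).trace ≠ 0)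
    (h : sqNorm A b x / (A x).trace ^ 2 ≤ 1 / (n - 1 + δ)) :
    sqNorm (fun y => renormA A b y - 1) (renormb A b) x ≤ 1 - δ := by
  have hn : (1 : ℝ) ≤ n := by
    obtain rfl | hn := Nat.eq_zero_or_pos n
    · exact absurd (Matrix.trace_eq_zero_of_isEmpty _) htr
    · exact_mod_cast hn
  have htr2 : 0 < (A x).trace ^ 2 := by positivity
  have hpos : 0 < sqNorm A b x := by
    refine (sqNorm_nonneg A b x).lt_of_ne fun h0 => htr (Finset.sum_eq_zero fun i _ => ?_)
    exact pow_eq_zero_iff two_ne_zero |>.1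
      (le_antisymm (h0 ▸ sq_entry_le_sqNorm A b x i i) (sq_nonneg _))
  have hquot : (n : ℝ) - 1 + δ ≤ (A x).trace ^ 2 / sqNorm A b x := by
    rw [div_le_div_iff₀ htr2 (by linarith)] at h
    rw [le_div_iff₀ hpos]
    linarith
  rw [sqNorm_renorm_sub_one]
  linarith

end Pointwise

variable {A : (Fin n → ℝ) → Matrix (Fin n) (Fin n) ℝ} {b : (Fin n → ℝ) → Fin n → ℝ}

/-- The coefficients `A` and `b` are essentially bounded on the unit cell. -/
structure IsEssBounded (A : (Fin n → ℝ) → Matrix (Fin n) (Fin n) ℝ)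
    (b : (Fin n → ℝ) → Fin n → ℝ) : Prop where
  memLp_entry : ∀ i j, MemLp (fun x => A x i j) ⊤ (cellMeasure n)
  memLp_drift : ∀ i, MemLp (fun x => b x i) ⊤ (cellMeasure n)

theorem IsEssBounded.sub_one (h : IsEssBounded A b) : IsEssBounded (fun x => A x - 1) b :=
  ⟨fun i j => (h.memLp_entry i j).sub (memLp_const ((1 : Matrix (Fin n) (Fin n) ℝ) i j)),
    h.memLp_drift⟩

theorem isEssBounded_renorm (hA : ∀ i j, AEMeasurable (fun x => A x i j) (cellMeasure n))
    (hb : ∀ i, AEMeasurable (fun x => b x i) (cellMeasure n)) :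
    IsEssBounded (renormA A b) (renormb A b) := by
  have htrace : AEMeasurable (fun x => (A x).trace) (cellMeasure n) :=
    Finset.aemeasurable_fun_sum _ fun i _ => hA i i
  have hsqNorm : AEMeasurable (sqNorm A b) (cellMeasure n) :=
    (Finset.aemeasurable_fun_sum _ fun i _ => Finset.aemeasurable_fun_sum _ fun j _ =>
      (hA i j).pow_const 2).add (Finset.aemeasurable_fun_sum _ fun i _ => (hb i).pow_const 2)
  have hgam : AEMeasurable (gam A b) (cellMeasure n) := htrace.div hsqNorm
  exact ⟨fun i j => memLp_top_of_bound (hgam.mul (hA i j)).aestronglyMeasurable (√n)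
      (.of_forall fun x => Real.abs_le_sqrt <|
        (sq_entry_le_sqNorm (renormA A b) (renormb A b) x i j).trans (sqNorm_renorm_le A b x)),
    fun i => memLp_top_of_bound (hgam.mul (hb i)).aestronglyMeasurable (√n)
      (.of_forall fun x => Real.abs_le_sqrt <|
        (sq_drift_le_sqNorm (renormA A b) (renormb A b) x i).trans (sqNorm_renorm_le A b x))⟩

/-- Multiplication by an essentially bounded function on `L²_per(Y)`. -/
def mulCLM {a : (Fin n → ℝ) → ℝ} (ha : MemLp a ⊤ (cellMeasure n)) : L2per n →L[ℝ] L2per n :=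
  (ContinuousLinearMap.mul ℝ ℝ).holderL (cellMeasure n) ⊤ 2 2 (ha.toLp a)

theorem coeFn_mulCLM {a : (Fin n → ℝ) → ℝ} (ha : MemLp a ⊤ (cellMeasure n)) (u : L2per n) :
    mulCLM ha u =ᵐ[cellMeasure n] fun x => a x * u x := by
  filter_upwards [ContinuousLinearMap.coeFn_holder (r := 2) (ContinuousLinearMap.mul ℝ ℝ)
    (ha.toLp a) u, ha.coeFn_toLp] with x hmul hx
  rw [← hx]
  exact hmul

/-- The operator `w ↦ A : Dw + b · w`. -/
def firstOrderCLM (h : IsEssBounded A b) : H1perZero n →L[ℝ] L2per n :=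
  ∑ i, ∑ j, (mulCLM (h.memLp_entry i j)).comp (gradCLM i j) +
    ∑ i, (mulCLM (h.memLp_drift i)).comp (compCLM i)

theorem coeFn_firstOrderCLM (h : IsEssBounded A b) (w : H1perZero n) :
    firstOrderCLM h w =ᵐ[cellMeasure n] firstOrderTerm A b (grad w) (comp w) := by
  have hentry : ∀ᵐ x ∂cellMeasure n, ∀ i j,
      mulCLM (h.memLp_entry i j) (grad w i j) x = A x i j * grad w i j x :=
    ae_all_iff.2 fun i => ae_all_iff.2 fun j => coeFn_mulCLM _ _
  have hdrift : ∀ᵐ x ∂cellMeasure n, ∀ i,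
      mulCLM (h.memLp_drift i) (comp w i) x = b x i * comp w i x :=
    ae_all_iff.2 fun i => coeFn_mulCLM _ _
  have hrow : ∀ᵐ x ∂cellMeasure n, ∀ i,
      (∑ j, mulCLM (h.memLp_entry i j) (grad w i j) : L2per n) x =
        ∑ j, mulCLM (h.memLp_entry i j) (grad w i j) x :=
    ae_all_iff.2 fun i => Lp.coeFn_fun_finsetSum _ _
  have happly : firstOrderCLM h w = ∑ i, ∑ j, mulCLM (h.memLp_entry i j) (grad w i j) +
      ∑ i, mulCLM (h.memLp_drift i) (comp w i) := by
    simp [firstOrderCLM, gradCLM_apply, compCLM_apply]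
  rw [happly]
  filter_upwards [hentry, hdrift, hrow, Lp.coeFn_add
    (∑ i, ∑ j, mulCLM (h.memLp_entry i j) (grad w i j))
    (∑ i, mulCLM (h.memLp_drift i) (comp w i)),
    Lp.coeFn_fun_finsetSum Finset.univ fun i => ∑ j, mulCLM (h.memLp_entry i j) (grad w i j),
    Lp.coeFn_fun_finsetSum Finset.univ fun i => mulCLM (h.memLp_drift i) (comp w i)]
    with x hentry hdrift hrow hadd hsum hsum'
  simp only [hadd, Pi.add_apply, hsum, hsum', hrow, hentry, hdrift, firstOrderTerm]

theorem firstOrderCLM_sub_one (h : IsEssBounded A b) (w : H1perZero n) :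
    firstOrderCLM h.sub_one w = firstOrderCLM h w - divCLM n w := by
  refine Lp.ext ?_
  filter_upwards [coeFn_firstOrderCLM h.sub_one w, coeFn_firstOrderCLM h w, coeFn_divCLM w,
    Lp.coeFn_sub (firstOrderCLM h w) (divCLM n w)] with x hsub hA hdiv hdiff
  rw [hsub, hdiff, Pi.sub_apply, hA, hdiv, firstOrderTerm_sub_one]

theorem integrable_sq (u : L2per n) : Integrable (fun x => u x ^ 2) (cellMeasure n) :=
  (Lp.memLp u).integrable_sq

theorem norm_sq_eq_integral (u : L2per n) : ‖u‖ ^ 2 = ∫ x in unitCell n, u x ^ 2 := by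
  rw [← real_inner_self_eq_norm_sq, inner_eq_integral]
  simp only [sq]

theorem integrable_sum_sq_grad (w : H1perZero n) (i : Fin n) :
    Integrable (fun x => ∑ j, grad w i j x ^ 2) (cellMeasure n) :=
  integrable_finsetSum _ fun j _ => integrable_sq (grad w i j)

theorem integrable_sum_sq_grad_add_sum_sq_comp (w : H1perZero n) :
    Integrable (fun x => (∑ i, ∑ j, grad w i j x ^ 2) + ∑ i, comp w i x ^ 2) (cellMeasure n) :=
  (integrable_finsetSum _ fun i _ => integrable_sum_sq_grad w i).add
    (integrable_finsetSum _ fun i _ => integrable_sq (comp w i))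

theorem norm_sq_H1perZero_eq_integral (w : H1perZero n) :
    ‖w‖ ^ 2 = ∫ x in unitCell n, ((∑ i, ∑ j, grad w i j x ^ 2) + ∑ i, comp w i x ^ 2) := by
  rw [integral_add (integrable_finsetSum _ fun i _ => integrable_sum_sq_grad w i)
      (integrable_finsetSum _ fun i _ => integrable_sq (comp w i)),
    integral_finsetSum _ fun i _ => integrable_sum_sq_grad w i,
    integral_finsetSum _ fun i _ => integrable_sq (comp w i), norm_sq_H1perZero, add_comm]
  simp only [integral_finsetSum _ fun j _ => integrable_sq (grad w _ j), norm_sq_eq_integral]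

theorem norm_sq_firstOrderCLM_le (h : IsEssBounded A b) {ε : ℝ}
    (hε : ∀ᵐ x ∂cellMeasure n, sqNorm A b x ≤ ε) (w : H1perZero n) :
    ‖firstOrderCLM h w‖ ^ 2 ≤ ε * ‖w‖ ^ 2 := by
  rw [norm_sq_eq_integral, norm_sq_H1perZero_eq_integral, ← integral_const_mul]
  refine integral_mono_ae (integrable_sq _)
    ((integrable_sum_sq_grad_add_sum_sq_comp w).const_mul ε) ?_
  filter_upwards [hε, coeFn_firstOrderCLM h w] with x hx hT
  simp only [hT]
  refine (sq_firstOrderTerm_le A b x _ _).trans ?_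
  gcongr

/-! ### The bilinear form -/

theorem integral_skew (v w : H1perZero n) :
    ∫ x in unitCell n, ∑ i, ∑ j, (grad v i j x - grad v j i x) * (grad w i j x - grad w j i x) =
      ∑ i, ∑ j, inner ℝ (grad v i j - grad v j i) (grad w i j - grad w j i) := by
  have hsub (u : H1perZero n) : ∀ᵐ x ∂cellMeasure n, ∀ i j,
      (grad u i j - grad u j i : L2per n) x = grad u i j x - grad u j i x :=
    ae_all_iff.2 fun i => ae_all_iff.2 fun j => Lp.coeFn_sub _ _
  have hint (i j) : Integrable (fun x => (grad v i j - grad v j i : L2per n) x *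
      (grad w i j - grad w j i : L2per n) x) (cellMeasure n) :=
    (Lp.memLp _).integrable_mul (Lp.memLp _)
  simp only [inner_eq_integral, ← integral_finsetSum _ fun j _ => hint _ j]
  rw [← integral_finsetSum _ fun i _ => integrable_finsetSum _ fun j _ => hint i j]
  refine integral_congr_ae ?_
  filter_upwards [hsub v, hsub w] with x hv hw
  simp only [hv, hw]

theorem bilinForm_eq_inner (h : IsEssBounded A b) (v w : H1perZero n) :
    bilinForm A b v w = inner ℝ (divCLM n v) (firstOrderCLM h w) +
      (1 / 2) * ∑ i, ∑ j, inner ℝ (grad v i j - grad v j i) (grad w i j - grad w j i) := by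
  rw [bilinForm, integral_skew, inner_eq_integral]
  congr 1
  refine integral_congr_ae ?_
  filter_upwards [coeFn_divCLM v, coeFn_firstOrderCLM h w] with x hdiv hT
  rw [hdiv, hT]

/-- The inner product of `L²_per(Y)` as a bounded bilinear form. -/
def innerCLM (n : ℕ) : L2per n →L[ℝ] L2per n →L[ℝ] ℝ :=
  isBoundedBilinearMap_inner.toContinuousLinearMap

theorem innerCLM_apply (u v : L2per n) : innerCLM n u v = inner ℝ u v := rfl

/-- The form `bilinForm A b` as a bounded operator from `H¹_{per,0}(Y;ℝ^n)` to its dual. -/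
def bilinCLM (h : IsEssBounded A b) : H1perZero n →L[ℝ] H1perZero n →L[ℝ] ℝ :=
  (innerCLM n).bilinearComp (divCLM n) (firstOrderCLM h) + (1 / 2 : ℝ) • ∑ i, ∑ j,
    (innerCLM n).bilinearComp (gradCLM i j - gradCLM j i) (gradCLM i j - gradCLM j i)

theorem bilinCLM_apply (h : IsEssBounded A b) (v w : H1perZero n) :
    bilinCLM h v w = bilinForm A b v w := by
  rw [bilinForm_eq_inner h]
  simp only [bilinCLM, add_apply, smul_apply, sum_apply, sub_apply,
    ContinuousLinearMap.bilinearComp_apply, innerCLM_apply, gradCLM_apply, smul_eq_mul]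

theorem isBoundedBilinearMap_bilinForm (h : IsEssBounded A b) :
    IsBoundedBilinearMap ℝ fun q : H1perZero n × H1perZero n => bilinForm A b q.1 q.2 := by
  simp only [← bilinCLM_apply h]
  exact (bilinCLM h).isBoundedBilinearMap

theorem bilinForm_self_eq (h : IsEssBounded A b) (w : H1perZero n) :
    bilinForm A b w w = (∑ i, ∑ j, ‖grad w i j‖ ^ 2) +
      inner ℝ (divCLM n w) (firstOrderCLM h w - divCLM n w) := by
  rw [bilinForm_eq_inner h, inner_sub_right]
  simp only [real_inner_self_eq_norm_sq]
  rw [half_sum_norm_sq_grad_sub]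
  ring

theorem mul_norm_sq_le_bilinForm_self (h : IsEssBounded A b) {ε : ℝ}
    (hε : ∀ᵐ x ∂cellMeasure n, sqNorm (fun y => A y - 1) b x ≤ ε) (w : H1perZero n) :
    (4 * Real.pi ^ 2 / (1 + 4 * Real.pi ^ 2) - ε) / 2 * ‖w‖ ^ 2 ≤ bilinForm A b w w := by
  have hclose := norm_sq_firstOrderCLM_le h.sub_one hε w
  rw [firstOrderCLM_sub_one h] at hclose
  have hgrad : 4 * Real.pi ^ 2 / (1 + 4 * Real.pi ^ 2) * ‖w‖ ^ 2 ≤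
      ∑ i, ∑ j, ‖grad w i j‖ ^ 2 := by
    rw [div_mul_eq_mul_div, div_le_iff₀' (by positivity)]
    exact four_pi_sq_mul_norm_sq_le w
  have hyoung : -(‖divCLM n w‖ ^ 2 + ‖firstOrderCLM h w - divCLM n w‖ ^ 2) / 2 ≤
      inner ℝ (divCLM n w) (firstOrderCLM h w - divCLM n w) := by
    have hsq := norm_add_sq_real (divCLM n w) (firstOrderCLM h w - divCLM n w)
    linarith [sq_nonneg ‖divCLM n w + (firstOrderCLM h w - divCLM n w)‖]
  rw [bilinForm_self_eq h, div_mul_eq_mul_div, sub_mul]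
  linarith [norm_divCLM_sq_le w]

theorem IsGradient.bilinForm_eq (h : IsEssBounded A b) (v : H1perZero n) {w : H1perZero n}
    (hw : IsGradient w) : bilinForm A b v w = inner ℝ (divCLM n v) (firstOrderCLM h w) := by
  have hskew (i j : Fin n) : grad w i j - grad w j i = 0 := sub_eq_zero.2 (hw.grad_symm i j)
  simp [bilinForm_eq_inner h, hskew]

theorem lax_milgram {V : Type*} [NormedAddCommGroup V] [InnerProductSpace ℝ V] [CompleteSpace V]
    {a : V → V → ℝ} (ha : IsBoundedBilinearMap ℝ fun q : V × V => a q.1 q.2) {c : ℝ} (hc : 0 < c)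
    (hcoer : ∀ w, c * ‖w‖ ^ 2 ≤ a w w) {f : V → ℝ} (hf : IsBoundedLinearMap ℝ f) :
    ∃ u, ∀ v, (∀ w, a v w = f w) ↔ v = u := by
  have hB : IsCoercive ha.toContinuousLinearMap := ⟨c, hc, fun w => by
    rw [mul_assoc, ← sq]
    exact hcoer w⟩
  have hiff (v : V) : (∀ w, a v w = f w) ↔ hB.continuousLinearEquivOfBilin v =
      (InnerProductSpace.toDual ℝ V).symm hf.toContinuousLinearMap := by
    rw [LinearIsometryEquiv.eq_symm_apply, ContinuousLinearMap.ext_iff]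
    simp only [InnerProductSpace.toDual_apply_apply, hB.continuousLinearEquivOfBilin_apply]
    rfl
  refine ⟨hB.continuousLinearEquivOfBilin.symm
    ((InnerProductSpace.toDual ℝ V).symm hf.toContinuousLinearMap), fun v => ?_⟩
  rw [hiff, ContinuousLinearEquiv.eq_symm_apply]

/-! ### The very weak solution -/

/-- The constant function `1` as an element of `L²_per(Y)`. -/
def oneL2 (n : ℕ) : L2per n := Lp.const 2 (cellMeasure n) 1

theorem coeFn_oneL2 (n : ℕ) : oneL2 n =ᵐ[cellMeasure n] fun _ => 1 := Lp.coeFn_const _ _ _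

theorem inner_oneL2 (u : L2per n) : inner ℝ (oneL2 n) u = ∫ x in unitCell n, u x := by
  rw [inner_eq_integral]
  refine integral_congr_ae ?_
  filter_upwards [coeFn_oneL2 n] with x hx
  rw [hx, one_mul]

theorem inner_oneL2_firstOrderCLM (h : IsEssBounded A b) (w : H1perZero n) :
    inner ℝ (oneL2 n) (firstOrderCLM h w) =
      ∫ x in unitCell n, firstOrderTerm A b (grad w) (comp w) x := by
  rw [inner_oneL2, integral_congr_ae (coeFn_firstOrderCLM h w)]

theorem isBoundedLinearMap_integral_firstOrderTerm (h : IsEssBounded A b) :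
    IsBoundedLinearMap ℝ fun w : H1perZero n =>
      ∫ x in unitCell n, firstOrderTerm A b (grad w) (comp w) x := by
  simp only [← inner_oneL2_firstOrderCLM h]
  exact ((innerSL ℝ (oneL2 n)).comp (firstOrderCLM h)).isBoundedLinearMap

theorem isVeryWeakSolution_iff (h : IsEssBounded A b) (r : L2per n) :
    IsVeryWeakSolution A b r ↔ ∀ v, IsGradient v → inner ℝ r (firstOrderCLM h v) = 0 := by
  have hinner (v : H1perZero n) : inner ℝ r (firstOrderCLM h v) =
      ∫ x in unitCell n, r x * firstOrderTerm A b (grad v) (comp v) x := by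
    rw [inner_eq_integral]
    refine integral_congr_ae ?_
    filter_upwards [coeFn_firstOrderCLM h v] with x hx
    rw [hx]
  simp only [hinner]
  refine ⟨fun hr v ⟨φ, hφ⟩ => hr φ (comp v) (grad v) hφ (isWeakPartial_grad v),
    fun hr φ p H hp hH => ?_⟩
  obtain ⟨v, hv, rfl, rfl⟩ := exists_isGradient hp hH
  exact hr v hv

theorem isVeryWeakSolution_sub_divCLM (h : IsEssBounded A b) {ρ : H1perZero n}
    (hρ : ∀ w, bilinForm A b ρ w =
      ∫ x in unitCell n, firstOrderTerm A b (grad w) (comp w) x) :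
    IsVeryWeakSolution A b (oneL2 n - divCLM n ρ) :=
  (isVeryWeakSolution_iff h _).2 fun v hv => by
    rw [inner_sub_left, ← hv.bilinForm_eq h, hρ, inner_oneL2_firstOrderCLM, sub_self]

theorem integral_oneL2_sub_divCLM (v : H1perZero n) :
    ∫ x in unitCell n, (oneL2 n - divCLM n v : L2per n) x = 1 := by
  have hone : ∫ x in unitCell n, oneL2 n x = 1 := by
    rw [integral_congr_ae (coeFn_oneL2 n)]
    simp
  rw [← inner_oneL2, inner_sub_right, inner_oneL2, inner_oneL2, integral_divCLM, hone, sub_zero]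

theorem IsVeryWeakSolution.unique (h : IsEssBounded A b) {c : ℝ} (hc : 0 < c)
    (hcoer : ∀ w : H1perZero n, c * ‖w‖ ^ 2 ≤ bilinForm A b w w) {r r' : L2per n}
    (hr : IsVeryWeakSolution A b r) (hr' : IsVeryWeakSolution A b r')
    (hint : ∫ x in unitCell n, r x = ∫ x in unitCell n, r' x) : r = r' := by
  -- `r - r'` has zero mean, hence is `∇·v` for a gradient `v`, and then `B(v, v) = 0`.
  obtain ⟨v, hv, hdiv⟩ := exists_isGradient_divCLM_eq (q := r - r') (by
    rw [← inner_oneL2, inner_sub_right, inner_oneL2, inner_oneL2, hint, sub_self])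
  have hzero : bilinForm A b v v = 0 := by
    rw [hv.bilinForm_eq h, hdiv, inner_sub_left, (isVeryWeakSolution_iff h r).1 hr v hv,
      (isVeryWeakSolution_iff h r').1 hr' v hv, sub_zero]
  have hnorm : ‖v‖ ^ 2 ≤ 0 := nonpos_of_mul_nonpos_right (hzero ▸ hcoer v) hc
  obtain rfl : v = 0 := by simpa using hnorm.antisymm (sq_nonneg _)
  rw [← sub_eq_zero, ← hdiv, map_zero]

theorem isVeryWeakSolution_and_integral_eq_one_iff (h : IsEssBounded A b) {c : ℝ} (hc : 0 < c)
    (hcoer : ∀ w : H1perZero n, c * ‖w‖ ^ 2 ≤ bilinForm A b w w) {ρ : H1perZero n}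
    (hρ : ∀ w, bilinForm A b ρ w =
      ∫ x in unitCell n, firstOrderTerm A b (grad w) (comp w) x) (r : L2per n) :
    (IsVeryWeakSolution A b r ∧ (∫ x in unitCell n, r x) = 1) ↔
      r =ᵐ[cellMeasure n] fun x => 1 - div ρ x := by
  have hsol := isVeryWeakSolution_sub_divCLM h hρ
  have hmean := integral_oneL2_sub_divCLM ρ
  have hae : (oneL2 n - divCLM n ρ : L2per n) =ᵐ[cellMeasure n] fun x => 1 - div ρ x := by
    filter_upwards [Lp.coeFn_sub (oneL2 n) (divCLM n ρ), coeFn_oneL2 n, coeFn_divCLM ρ]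
      with x hsub hone hdiv
    rw [hsub, Pi.sub_apply, hone, hdiv]
  refine ⟨fun ⟨hr, hr1⟩ => ?_, fun hr => ?_⟩
  · rwa [hr.unique h hc hcoer hsol (hr1.trans hmean.symm)]
  · obtain rfl : r = oneL2 n - divCLM n ρ := Lp.ext (hr.trans hae.symm)
    exact ⟨hsol, hmean⟩

theorem SettingB.aemeasurable_entry (h : SettingB A b) (i j : Fin n) :
    AEMeasurable (fun x => A x i j) (cellMeasure n) :=
  (h.memLp_A i j).aestronglyMeasurable.aemeasurable.restrict

theorem SettingB.aemeasurable_drift (h : SettingB A b) (i : Fin n) :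
    AEMeasurable (fun x => b x i) (cellMeasure n) :=
  (h.memLp_b i).aestronglyMeasurable.aemeasurable.restrict

theorem SettingB.trace_ne_zero (hn : 0 < n) (h : SettingB A b) :
    ∀ᵐ x ∂cellMeasure n, (A x).trace ≠ 0 := by
  obtain ⟨lam, _, hlam, _, hell⟩ := h.elliptic
  filter_upwards [ae_restrict_of_ae hell] with x hx
  refine (Finset.sum_pos (fun i _ => hlam.trans_le ?_) ⟨⟨0, hn⟩, Finset.mem_univ _⟩).ne'
  simpa using (hx (Pi.single i 1)).1

theorem SettingB.exists_cordes (hn : 0 < n) (h : SettingB A b) :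
    ∃ δ : ℝ, 1 / (1 + 4 * Real.pi ^ 2) < δ ∧
      ∀ᵐ x ∂cellMeasure n, sqNorm A b x / (A x).trace ^ 2 ≤ 1 / (n - 1 + δ) := by
  obtain ⟨δ, hδ, -, hcordes⟩ := h.cordes
  refine ⟨δ, lt_of_le_of_lt ?_ hδ, ae_restrict_of_ae hcordes⟩
  have hn1 : (1 : ℝ) ≤ n := by exact_mod_cast hn
  rw [div_le_div_iff₀ (by positivity) (by positivity)]
  nlinarith [sq_nonneg Real.pi]

end PeriodicFPK

end

theorem lemma2p11_general {n : ℕ} {A : (Fin n → ℝ) → Matrix (Fin n) (Fin n) ℝ}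
    {b : (Fin n → ℝ) → Fin n → ℝ}
    (hA : ∀ i j, AEMeasurable (fun x => A x i j) (volume.restrict (PeriodicFPK.unitCell n)))
    (hb : ∀ i, AEMeasurable (fun x => b x i) (volume.restrict (PeriodicFPK.unitCell n)))
    (htr : ∀ᵐ x ∂volume.restrict (PeriodicFPK.unitCell n), (A x).trace ≠ 0)
    {δ : ℝ} (hδ : 1 / (1 + 4 * Real.pi ^ 2) < δ)
    (hcordes : ∀ᵐ x ∂volume.restrict (PeriodicFPK.unitCell n),
      PeriodicFPK.sqNorm A b x / (A x).trace ^ 2 ≤ 1 / (n - 1 + δ)) :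
    IsBoundedBilinearMap ℝ (fun q : PeriodicFPK.H1perZero n × PeriodicFPK.H1perZero n =>
      PeriodicFPK.bilinForm (PeriodicFPK.renormA A b) (PeriodicFPK.renormb A b) q.1 q.2) ∧
    (∃ c : ℝ, 0 < c ∧ ∀ w : PeriodicFPK.H1perZero n,
      c * ‖w‖ ^ 2 ≤
        PeriodicFPK.bilinForm (PeriodicFPK.renormA A b) (PeriodicFPK.renormb A b) w w) ∧
    ∃ ρ : PeriodicFPK.H1perZero n,
      (∀ ρ' : PeriodicFPK.H1perZero n,
        (∀ w : PeriodicFPK.H1perZero n,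
          PeriodicFPK.bilinForm (PeriodicFPK.renormA A b) (PeriodicFPK.renormb A b) ρ' w =
            ∫ x in PeriodicFPK.unitCell n,
              PeriodicFPK.firstOrderTerm (PeriodicFPK.renormA A b) (PeriodicFPK.renormb A b)
                (PeriodicFPK.grad w) (PeriodicFPK.comp w) x) ↔ ρ' = ρ) ∧
      ∀ r : PeriodicFPK.L2per n,
        (PeriodicFPK.IsVeryWeakSolution (PeriodicFPK.renormA A b) (PeriodicFPK.renormb A b) r ∧
          (∫ x in PeriodicFPK.unitCell n, r x) = 1) ↔
        r =ᵐ[volume.restrict (PeriodicFPK.unitCell n)] fun x => 1 - PeriodicFPK.div ρ x := by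
  have hbdd := PeriodicFPK.isEssBounded_renorm hA hb
  have hδ0 : 0 < δ := lt_trans (by positivity) hδ
  have hclose : ∀ᵐ x ∂volume.restrict (PeriodicFPK.unitCell n), PeriodicFPK.sqNorm
      (fun y => PeriodicFPK.renormA A b y - 1) (PeriodicFPK.renormb A b) x ≤ 1 - δ := by
    filter_upwards [htr, hcordes] with x hx hx'
    exact PeriodicFPK.sqNorm_renorm_sub_one_le hδ0 hx hx'
  have hc : 0 < (4 * Real.pi ^ 2 / (1 + 4 * Real.pi ^ 2) - (1 - δ)) / 2 := by
    have hsum : 4 * Real.pi ^ 2 / (1 + 4 * Real.pi ^ 2) + 1 / (1 + 4 * Real.pi ^ 2) = 1 := by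
      rw [← add_div, add_comm, div_self (by positivity)]
    linarith
  have hbound := PeriodicFPK.isBoundedBilinearMap_bilinForm hbdd
  have hcoer := PeriodicFPK.mul_norm_sq_le_bilinForm_self hbdd hclose
  obtain ⟨ρ, hρ⟩ := PeriodicFPK.lax_milgram hbound hc hcoer
    (PeriodicFPK.isBoundedLinearMap_integral_firstOrderTerm hbdd)
  exact ⟨hbound, ⟨_, hc, hcoer⟩, ρ, hρ,
    PeriodicFPK.isVeryWeakSolution_and_integral_eq_one_iff hbdd hc hcoer ((hρ ρ).2 rfl)⟩

theorem lemma2p11 (n : ℕ) (hn : 0 < n)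
    (A : (Fin n → ℝ) → Matrix (Fin n) (Fin n) ℝ) (b : (Fin n → ℝ) → Fin n → ℝ)
    (hAb : PeriodicFPK.SettingB A b) :
    -- boundedness and bilinearity
    IsBoundedBilinearMap ℝ (fun q : PeriodicFPK.H1perZero n × PeriodicFPK.H1perZero n =>
      PeriodicFPK.bilinForm (PeriodicFPK.renormA A b) (PeriodicFPK.renormb A b) q.1 q.2) ∧
    -- coercivity
    (∃ c : ℝ, 0 < c ∧ ∀ w : PeriodicFPK.H1perZero n,
      c * ‖w‖ ^ 2 ≤
        PeriodicFPK.bilinForm (PeriodicFPK.renormA A b) (PeriodicFPK.renormb A b) w w) ∧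
    -- existence and uniqueness of `ρ`, and the characterization of the solution `r`
    ∃ ρ : PeriodicFPK.H1perZero n,
      (∀ ρ' : PeriodicFPK.H1perZero n,
        (∀ w : PeriodicFPK.H1perZero n,
          PeriodicFPK.bilinForm (PeriodicFPK.renormA A b) (PeriodicFPK.renormb A b) ρ' w =
            ∫ x in PeriodicFPK.unitCell n,
              PeriodicFPK.firstOrderTerm (PeriodicFPK.renormA A b) (PeriodicFPK.renormb A b)
                (PeriodicFPK.grad w) (PeriodicFPK.comp w) x) ↔ ρ' = ρ) ∧
      ∀ r : PeriodicFPK.L2per n,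
        (PeriodicFPK.IsVeryWeakSolution (PeriodicFPK.renormA A b) (PeriodicFPK.renormb A b) r ∧
          (∫ x in PeriodicFPK.unitCell n, r x) = 1) ↔
        r =ᵐ[MeasureTheory.volume.restrict (PeriodicFPK.unitCell n)] fun x => 1 - PeriodicFPK.div ρ x := by
  obtain ⟨δ, hδ, hcordes⟩ := hAb.exists_cordes hn
  exact lemma2p11_general hAb.aemeasurable_entry hAb.aemeasurable_drift (hAb.trace_ne_zero hn) hδ
    hcordes
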